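/- Let $n,m\ge 1$ and let $(X_i,Y_i)_{1\le i\le n+m}$ be random pairs in $\mathcal X\times\mathbb R$; items $1,\dots,n$ are calibration items and items $n+1,\dots,n+m$ are test items. For $y\in\mathbb R$ and a finite multiset $D$ of reals put $\mathrm{Rank}(y,D)=\sum_{z\in D}\mathbf 1\{y\ge z\}$, and let $R^{c+t}_i=\mathrm{Rank}(Y_i,\{Y_j\}_{1\le j\le n+m})$ and $R^{t}_i=\mathrm{Rank}(Y_i,\{Y_{n+j}\}_{1\le j\le m})$. Assume that $(Y_i)_{i\le n+m}$ is exchangeable and almost surely has no ties, and that $(X_i,R^{c+t}_i)_{i\le n+m}$ is exchangeable. Let $s(x,r,D)\in\mathbb R$ be a (measurable) score function of a point $x\in\mathcal X$, a rank $r$ and a finite multiset $D$ of points of $\mathcal X$. Let $\alpha\in(0,1)$, $\delta\in\mathbb R$, and let $R_j^-,R_j^+$ ($1\le j\le n$) be real random variables with $$\mathbb P\big(\forall j\in\{1,\dots,n\}:\ R^{c+t}_j\in[R_j^-,R_j^+]\big)\ge 1-\delta .$$ Put $$S_j=\max_{r\in[R_j^-,R_j^+]\cap\{1,\dots,n+m\}}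 s\big(X_j,r,\{X_l\}_{l\le n+m}\big),\qquad 1\le j\le n$$ (with $\max\emptyset=-\infty$), let $S_{(k)}$ be the $k$-th smallest of $S_1,\dots,S_n,+\infty$, and let $$\widehat C_k(x)=\big\{r\in\{1,\dots,n+m\}:\ s(x,r,\{X_l\}_{l\le n+m})\le S_{(k)}\big\}.$$ For $1\le i\le m$ let $a_{n+i}=\min\widehat C_k(X_{n+i})$, $b_{n+i}=\max\widehat C_k(X_{n+i})$, $$N^+_{n+i}=|\{j\le n: R_j^+\le a_{n+i}\}|,\qquad N^-_{n+i}=|\{j\le n: R_j^-\le b_{n+i}\}|,$$ $$\widehat C^t_k(X_{n+i})=[\,a_{n+i}-N^-_{n+i},\ b_{n+i}-N^+_{n+i}\,],$$ with $\widehat C^t_k(X_{n+i})=\emptyset$ if $\widehat C_k(X_{n+i})=\emptyset$. Then: (1) if $\delta<\alpha$ and $k=\lceil(1-\alpha+\delta)(n+1)\rceil$, then for every $i\in\{1,\dots,m\}$, $$\mathbb P\big(R^t_{n+i}\in\widehat C^t_k(X_{n+i})\big)\ge 1-\alpha;$$ (2) if $k=\lceil(1-\alpha)(n+1)\rceil$,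 then for every $\beta>0$, with probability at least $1-\beta-\delta$, $$\frac1m\sum_{i=1}^m\mathbf 1\big\{R^t_{n+i}\notin\widehat C^t_k(X_{n+i})\big\}\le\alpha+\lambda_{n,m},$$ where $\lambda_{n,m}=\sqrt{\dfrac{\log(C\sqrt{\tau_{n,m}}/\beta)}{\tau_{n,m}}}$ (read as $0$ if the logarithm is negative), $\tau_{n,m}=\dfrac{nm}{n+m}$ and $C=4\sqrt{2\pi}$. -/

import Mathlib

open MeasureTheory ProbabilityTheory

noncomputable section

namespace RankConformal

/-- The finite family `f` seen as a multiset. -/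
def bag {ι E : Type*} [Fintype ι] (f : ι → E) : Multiset E :=
  Finset.univ.val.map f

/-- `Rank (y, D) = ∑_{z ∈ D} 1{y ≥ z}`, multiplicities included. -/
def rank (y : ℝ) (D : Multiset ℝ) : ℕ :=
  (D.map fun z => if z ≤ y then 1 else 0).sum

/-- A finite random vector is exchangeable if permuting its coordinates does not change its law. -/
def IsExchangeable {Ω E : Type*} [MeasurableSpace Ω] [MeasurableSpace E] {N : ℕ}
    (P : Measure Ω) (Z : Fin N → Ω → E) : Prop :=
  ∀ σ : Equiv.Perm (Fin N), IdentDistrib (fun ω i => Z (σ i) ω) (fun ω i => Z i ω) P P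

/-- The `k`-th smallest element (`k ≥ 1`) of `S₁, …, Sₙ, +∞`: the least threshold that at least
`k` of the `Sᵢ` do not exceed. It is `+∞` when `k > n`. -/
def kthSmallest {n : ℕ} (S : Fin n → EReal) (k : ℕ) : EReal :=
  sInf {t : EReal | k ≤ (Finset.univ.filter fun i => S i ≤ t).card}

section Ranks

variable {n m : ℕ}

/-- The rank of item `i` among the test items. -/
def testRank (y : Fin (n + m) → ℝ) (i : Fin (n + m)) : ℕ :=
  rank (y i) (bag fun j : Fin m => y (Fin.natAdd n j))

/-- The rank of item `i` among all the `n + m` items. -/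
def fullRank (y : Fin (n + m) → ℝ) (i : Fin (n + m)) : ℕ :=
  rank (y i) (bag y)

end Ranks

section Sets

variable {n m : ℕ} {𝒳 : Type*}

/-- The proxy score of the calibration item `i`: the largest score `s (xᵢ, r, {x_j}_j)` over the
ranks `r ∈ {1, …, n + m}` of the interval `[lo i, hi i]` (with value `-∞` if there are none). -/
def proxyScore (s : 𝒳 → ℕ → Multiset 𝒳 → ℝ) (x : Fin (n + m) → 𝒳) (lo hi : Fin n → ℝ)
    (i : Fin n) : EReal :=
  ((Finset.Icc 1 (n + m)).filter fun r : ℕ => (r : ℝ) ∈ Set.Icc (lo i) (hi i)).sup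
    fun r => ((s (x (Fin.castAdd m i)) r (bag x) : ℝ) : EReal)

/-- The conformal set `Ĉ_k (z)` for the rank, among all the items, of an item with feature `z`. -/
def confSet (s : 𝒳 → ℕ → Multiset 𝒳 → ℝ) (x : Fin (n + m) → 𝒳) (lo hi : Fin n → ℝ)
    (k : ℕ) (z : 𝒳) : Set ℕ :=
  {r | r ∈ Finset.Icc 1 (n + m) ∧
    ((s z r (bag x) : ℝ) : EReal) ≤ kthSmallest (proxyScore s x lo hi) k}

/-- The number of calibration items whose envelope bound `R j` is at most `c`. -/
def boundCount (R : Fin n → ℝ) (c : ℕ) : ℕ :=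
  (Finset.univ.filter fun j => R j ≤ (c : ℝ)).card

/-- The shifted set `[a - N⁻, b - N⁺]`, where `a` and `b` are the minimum and the maximum of
`Ĉ_k (z)`, `N⁻ = #{j | lo j ≤ b}` and `N⁺ = #{j | hi j ≤ a}`.
It is empty when `Ĉ_k (z)` is empty. -/
def testConfSet (s : 𝒳 → ℕ → Multiset 𝒳 → ℝ) (x : Fin (n + m) → 𝒳) (lo hi : Fin n → ℝ)
    (k : ℕ) (z : 𝒳) : Set ℝ :=
  {t | ∃ a b : ℕ, IsLeast (confSet s x lo hi k z) a ∧ IsGreatest (confSet s x lo hi k z) b ∧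
    t ∈ Set.Icc ((a : ℝ) - (boundCount lo b : ℝ)) ((b : ℝ) - (boundCount hi a : ℝ))}

/-- The false coverage proportion of the shifted sets for the ranks among the test items. -/
def testFCP (s : 𝒳 → ℕ → Multiset 𝒳 → ℝ) (x : Fin (n + m) → 𝒳) (y : Fin (n + m) → ℝ)
    (lo hi : Fin n → ℝ) (k : ℕ) : ℝ :=
  (1 / (m : ℝ)) * ∑ i : Fin m,
    Set.indicator (testConfSet s x lo hi k (x (Fin.natAdd n i)))ᶜ (fun _ => (1 : ℝ))
      (testRank y (Fin.natAdd n i) : ℝ)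

end Sets

/-- `τ_{n,m} = n m / (n + m)`. -/
def tau (n m : ℕ) : ℝ := ((n : ℝ) * (m : ℝ)) / ((n : ℝ) + (m : ℝ))

/-- `λ_{n,m} = √(log (C √τ_{n,m} / β) / τ_{n,m})` with `C = 4 √(2π)`. -/
def lam (n m : ℕ) (β : ℝ) : ℝ :=
  √(Real.log (4 * √(2 * Real.pi) * √(tau n m) / β) / tau n m)

end RankConformal

end

/-! On the envelope event each proxy score dominates the score of the same calibration item at its
true rank. So if fewer than `k` calibration true scores lie strictly below that of a test item, the
full rank of that item lies in the conformal set (`fullRank_mem_confSet`). Its test rank is the full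
rank minus the number of calibration items ranked no higher, and the envelope traps that number
between `N⁺` and `N⁻` (`testRank_mem_testConfSet`). Only the true scores remain to be studied, at
the price `δ` of a union bound; they are exchangeable because the score sees all the features only
as a multiset.

Marginal coverage: of the `n + 1` scores of the calibration items and one test item, at least `k`
have fewer than `k` others strictly below, so by symmetry the test score does with probability at
least `k / (n + 1)`.

False coverage proportion: misses are bounded by exceedances. Averaging over all permutations of a
fixed vector reduces the tail to a count of permutations, where many exceedances force an atypical
number of calibration (or test) items into a block of extreme ranks. Hoeffding's inequality without
replacement (`card_perm_le_hits_le`) then gives `exp (-τ Δ²)`. -/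

namespace RankConformal

/-! ### Hoeffding's inequality for uniform permutations. -/

section Hypergeometric

variable {ι : Type*} [Fintype ι] [DecidableEq ι]

/-- The number of permutations sending `R` into `B`. -/
def permsInto (R B : Finset ι) : Finset (Equiv.Perm ι) :=
  Finset.univ.filter fun π => ∀ i ∈ R, π i ∈ B

lemma card_permsInto_insert_eq {R B : Finset ι} {i j : ι} (hi : i ∉ R) (hj : j ∉ R) :
    (permsInto (insert i R) B).card = (permsInto (insert j R) B).card := by
  refine Finset.card_bij (fun π _ => π * Equiv.swap i j) ?_ ?_ ?_
  · intro π hπ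
    simp only [permsInto, Finset.mem_filter, Finset.mem_univ, true_and,
      Finset.forall_mem_insert, Equiv.Perm.mul_apply, Equiv.swap_apply_right] at hπ ⊢
    refine ⟨hπ.1, fun l hl => ?_⟩
    rw [Equiv.swap_apply_of_ne_of_ne (by rintro rfl; exact hi hl) (by rintro rfl; exact hj hl)]
    exact hπ.2 l hl
  · intro π _ π' _ h
    exact mul_right_cancel h
  · intro π hπ
    refine ⟨π * Equiv.swap i j, ?_, by rw [mul_assoc, Equiv.swap_mul_self, mul_one]⟩
    simp only [permsInto, Finset.mem_filter, Finset.mem_univ, true_and,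
      Finset.forall_mem_insert, Equiv.Perm.mul_apply, Equiv.swap_apply_left] at hπ ⊢
    refine ⟨hπ.1, fun l hl => ?_⟩
    rw [Equiv.swap_apply_of_ne_of_ne (by rintro rfl; exact hi hl) (by rintro rfl; exact hj hl)]
    exact hπ.2 l hl

/-- Double counting of pairs `(π, j)`: a permutation sending `R` into `B` leaves exactly `|B| - |R|`
elements of `B` to be hit from outside `R`. Over `ℤ` this covers `|B| < |R|` too, where both sides
vanish. -/
lemma sum_card_permsInto_insert (R B : Finset ι) :
    ∑ j ∈ Rᶜ, ((permsInto (insert j R) B).card : ℤ)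
      = ((B.card : ℤ) - R.card) * (permsInto R B).card := by
  have h1 : ∀ j, permsInto (insert j R) B = (permsInto R B).filter fun π => π j ∈ B := by
    intro j; ext π
    simp only [permsInto, Finset.forall_mem_insert, Finset.mem_filter, Finset.mem_univ, true_and]
    tauto
  have h2 : ∀ π ∈ permsInto R B,
      ((Rᶜ.filter fun j => π j ∈ B).card : ℤ) = (B.card : ℤ) - R.card := by
    intro π hπ
    have hR : R ⊆ B.map π.symm.toEmbedding := by
      intro i hi
      have := (Finset.mem_filter.mp hπ).2 i hi
      simpa using this
    have : Rᶜ.filter (fun j => π j ∈ B) = B.map π.symm.toEmbedding \ R := by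
      ext j; simp [and_comm]
    rw [this, Finset.card_sdiff_of_subset hR, Finset.card_map, Nat.cast_sub]
    simpa using Finset.card_le_card hR
  simp_rw [h1, Finset.card_filter]
  push_cast
  rw [Finset.sum_comm]
  calc _ = ∑ π ∈ permsInto R B, ((B.card : ℤ) - R.card) := by
        refine Finset.sum_congr rfl fun π hπ => ?_
        rw [← h2 π hπ, Finset.card_filter]; push_cast; rfl
    _ = _ := by rw [Finset.sum_const, nsmul_eq_mul, mul_comm]

lemma card_mul_card_permsInto_insert_le {R B : Finset ι} {i : ι} (hi : i ∉ R) :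
    Fintype.card ι * (permsInto (insert i R) B).card ≤ B.card * (permsInto R B).card := by
  have hsum := sum_card_permsInto_insert R B
  rw [Finset.sum_congr rfl fun j hj => by
    rw [card_permsInto_insert_eq (Finset.mem_compl.mp hj) hi], Finset.sum_const,
    Finset.card_compl, nsmul_eq_mul, Nat.cast_sub (Finset.card_le_univ R)] at hsum
  have hlt : R.card < Fintype.card ι := by
    rw [← Finset.card_univ]
    exact Finset.card_lt_card (Finset.ssubset_univ_iff.mpr fun h => hi (h ▸ Finset.mem_univ i))
  have hB : B.card ≤ Fintype.card ι := Finset.card_le_univ B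
  generalize Fintype.card ι = N at *
  generalize (permsInto (insert i R) B).card = F' at *
  generalize (permsInto R B).card = F at *
  generalize R.card = r at *
  generalize B.card = b at *
  zify at *
  have hpos : (0 : ℤ) < (N : ℤ) - r := by linarith
  refine le_of_mul_le_mul_left ?_ hpos
  calc ((N : ℤ) - r) * (N * F') = N * ((b - r) * F) := by rw [← hsum]; ring
    -- The two sides differ by `r (N - b) F ≥ 0`, i.e. `(b - r) / (N - r) ≤ b / N`.
    _ ≤ (N - r) * (b * F) := by
      nlinarith [mul_nonneg (mul_nonneg (Int.natCast_nonneg r) (sub_nonneg.mpr hB))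
        (Int.natCast_nonneg F)]

lemma card_permsInto_le [Nonempty ι] (R B : Finset ι) :
    ((permsInto R B).card : ℝ)
      ≤ (Fintype.card ι).factorial * ((B.card : ℝ) / Fintype.card ι) ^ R.card := by
  have hN : (0 : ℝ) < Fintype.card ι := by exact_mod_cast Fintype.card_pos
  induction R using Finset.induction_on with
  | empty => simp [permsInto, Fintype.card_perm]
  | insert i R hi ih =>
    rw [Finset.card_insert_of_notMem hi, pow_succ]
    have h : (Fintype.card ι : ℝ) * (permsInto (insert i R) B).card
        ≤ B.card * (permsInto R B).card := by
      exact_mod_cast card_mul_card_permsInto_insert_le hi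
    calc ((permsInto (insert i R) B).card : ℝ)
        ≤ (B.card : ℝ) / Fintype.card ι * (permsInto R B).card := by
          rw [div_mul_eq_mul_div, le_div_iff₀ hN]; linarith
      _ ≤ (B.card : ℝ) / Fintype.card ι *
          ((Fintype.card ι).factorial * ((B.card : ℝ) / Fintype.card ι) ^ R.card) := by
          gcongr
      _ = _ := by ring

/-- The number of elements of `A` that the permutation `π` sends into `B`. -/
def hits (A B : Finset ι) (π : Equiv.Perm ι) : ℕ := (A.filter fun i => π i ∈ B).card

/-- Domination by the binomial generating function: expand the power over the subsets `R` of `A`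
sent into `B`, and bound each term as if the draws were independent. -/
lemma sum_pow_hits_le [Nonempty ι] (A B : Finset ι) {x : ℝ} (hx : 0 ≤ x) :
    ∑ π : Equiv.Perm ι, (1 + x) ^ hits A B π
      ≤ (Fintype.card ι).factorial * (1 + x * ((B.card : ℝ) / Fintype.card ι)) ^ A.card := by
  have h1 : ∀ π : Equiv.Perm ι, (1 + x) ^ hits A B π
      = ∑ R ∈ A.powerset, if π ∈ permsInto R B then x ^ R.card else 0 := by
    intro π
    have : (1 + x) ^ hits A B π = ∏ i ∈ A, (1 + if π i ∈ B then x else 0) := by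
      rw [hits, ← Finset.prod_const, Finset.prod_filter]
      exact Finset.prod_congr rfl fun i _ => by split_ifs <;> simp
    rw [this, Finset.prod_one_add]
    refine Finset.sum_congr rfl fun R _ => ?_
    split_ifs with h
    · rw [← Finset.prod_const]
      exact Finset.prod_congr rfl fun i hi => if_pos ((Finset.mem_filter.mp h).2 i hi)
    · simp only [permsInto, Finset.mem_filter, Finset.mem_univ, true_and, not_forall] at h
      obtain ⟨i, hi, hB⟩ := h
      exact Finset.prod_eq_zero hi (if_neg hB)
  simp_rw [h1]
  rw [Finset.sum_comm, add_comm 1, ← Finset.sum_pow_mul_eq_add_pow, Finset.mul_sum]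
  refine Finset.sum_le_sum fun R _ => ?_
  rw [← Finset.sum_filter, Finset.sum_const, nsmul_eq_mul]
  have : Finset.univ.filter (fun π => π ∈ permsInto R B) = permsInto R B := by ext; simp
  rw [this, mul_pow, one_pow, mul_one]
  calc _ ≤ _ := mul_le_mul_of_nonneg_right (card_permsInto_le R B) (pow_nonneg hx _)
    _ = _ := by ring

/-- Hoeffding's lemma for the two-point law `μ` on `{0, 1}`, with the centring moved to the
right-hand side. -/
lemma bernoulli_mgf_le {p : ℝ} (hp0 : 0 ≤ p) (hp1 : p ≤ 1) (s : ℝ) :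
    1 + (Real.exp s - 1) * p ≤ Real.exp (s * p + s ^ 2 / 8) := by
  let μ : Measure ℝ := ENNReal.ofReal (1 - p) • Measure.dirac 0 + ENNReal.ofReal p • Measure.dirac 1
  have hint : ∀ f : ℝ → ℝ, ∫ x, f x ∂μ = (1 - p) * f 0 + p * f 1 := by
    intro f
    have hd : ∀ (c a : ℝ), Integrable f (ENNReal.ofReal c • Measure.dirac a) := fun c a =>
      (integrable_dirac (by simp)).smul_measure ENNReal.ofReal_ne_top
    rw [integral_add_measure (hd _ _) (hd _ _), integral_smul_measure, integral_smul_measure,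
      integral_dirac, integral_dirac, ENNReal.toReal_ofReal (by linarith),
      ENNReal.toReal_ofReal hp0, smul_eq_mul, smul_eq_mul]
  have : IsProbabilityMeasure μ := ⟨by
    simp only [μ, Measure.add_apply, Measure.smul_apply, measure_univ, smul_eq_mul, mul_one]
    rw [← ENNReal.ofReal_add (by linarith) hp0]; simp⟩
  have hsub := hasSubgaussianMGF_of_mem_Icc (μ := μ) (X := id) (a := 0) (b := 1)
    aemeasurable_id (by
      simp only [μ, ae_add_measure_iff]
      constructor <;> refine Measure.ae_smul_measure ?_ _ <;> simp [ae_dirac_eq])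
  have h := hsub.mgf_le s
  simp only [mgf, hint, id] at h
  have key := mul_le_mul_of_nonneg_left h (Real.exp_nonneg (s * p))
  rw [← Real.exp_add] at key
  calc _ = Real.exp (s * p) * ((1 - p) * Real.exp (s * (0 - ((1 - p) * 0 + p * 1)))
        + p * Real.exp (s * (1 - ((1 - p) * 0 + p * 1)))) := by
        rw [mul_add, mul_left_comm, mul_left_comm _ p, ← Real.exp_add, ← Real.exp_add]
        ring_nf; simp; ring
    _ ≤ _ := key
    _ = _ := by congr 2; simp; ring

/-- Hoeffding's inequality for sampling without replacement. -/
lemma card_perm_le_hits_le [Nonempty ι] (A B : Finset ι) (hA : 0 < A.card) (k : ℕ)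
    (hk : (A.card : ℝ) * (B.card / Fintype.card ι) ≤ k) :
    ((Finset.univ.filter fun π : Equiv.Perm ι => k ≤ hits A B π).card : ℝ)
      ≤ (Fintype.card ι).factorial *
        Real.exp (-(2 * (k - A.card * ((B.card : ℝ) / Fintype.card ι)) ^ 2 / A.card)) := by
  have ha : (0 : ℝ) < A.card := by exact_mod_cast hA
  have hN : (0 : ℝ) < Fintype.card ι := by exact_mod_cast Fintype.card_pos
  have hp0 : 0 ≤ (B.card : ℝ) / Fintype.card ι := by positivity
  have hp1 : (B.card : ℝ) / Fintype.card ι ≤ 1 := by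
    rw [div_le_one hN]; exact_mod_cast Finset.card_le_univ B
  have hmain := fun x hx => sum_pow_hits_le A B (x := x) hx
  generalize (B.card : ℝ) / Fintype.card ι = p at *
  -- The minimiser of the Chernoff exponent `|A| (s p + s² / 8) - k s`.
  set s : ℝ := 4 * (k - A.card * p) / A.card with hs
  have hs0 : 0 ≤ s := div_nonneg (by linarith) ha.le
  have h1 := hmain (Real.exp s - 1) (by linarith [Real.one_le_exp hs0])
  rw [add_sub_cancel] at h1
  have h2 : ((Finset.univ.filter fun π : Equiv.Perm ι => k ≤ hits A B π).card : ℝ)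
      * Real.exp (k * s) ≤ ∑ π : Equiv.Perm ι, Real.exp s ^ hits A B π := by
    rw [← nsmul_eq_mul, ← Finset.sum_const]
    refine (Finset.sum_le_sum fun π hπ => ?_).trans
      (Finset.sum_le_sum_of_subset_of_nonneg (Finset.filter_subset _ _) fun _ _ _ => by positivity)
    rw [Real.exp_nat_mul]
    exact pow_le_pow_right₀ (Real.one_le_exp hs0) (Finset.mem_filter.mp hπ).2
  have h3 : (1 + (Real.exp s - 1) * p) ^ A.card ≤ Real.exp (A.card * (s * p + s ^ 2 / 8)) := by
    rw [Real.exp_nat_mul]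
    exact pow_le_pow_left₀
      (by nlinarith [Real.one_le_exp hs0]) (bernoulli_mgf_le hp0 hp1 s) _
  have h4 : (A.card : ℝ) * (s * p + s ^ 2 / 8)
      = -(2 * (k - A.card * p) ^ 2 / A.card) + k * s := by
    rw [hs]; field_simp; ring
  rw [h4, Real.exp_add] at h3
  refine le_of_mul_le_mul_right ?_ (Real.exp_pos (k * s))
  calc _ ≤ _ := h2.trans h1
    _ ≤ _ := mul_le_mul_of_nonneg_left h3 (Nat.cast_nonneg _)
    _ = _ := by ring

end Hypergeometric

end RankConformal

namespace RankConformal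

/-! ### Tail of the number of exceedances under a random permutation. -/

section Exceedances

variable {n m : ℕ}

/-- The number of calibration coordinates of `v` that are smaller than `c`. -/
def calBelow {E : Type*} [LT E] [DecidableLT E] (v : Fin (n + m) → E) (c : E) : ℕ :=
  (Finset.univ.filter fun j : Fin n => v (Fin.castAdd m j) < c).card

/-- The number of test coordinates of `v` that are larger than at least `k` calibration ones. -/
def exceedances {E : Type*} [LT E] [DecidableLT E] (k : ℕ) (v : Fin (n + m) → E) : ℕ :=
  (Finset.univ.filter fun i : Fin m => k ≤ calBelow v (v (Fin.natAdd n i))).card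

lemma exceedances_le_of_lt_imp_lt {E F : Type*} [LT E] [DecidableLT E] [LT F] [DecidableLT F]
    (k : ℕ) {v : Fin (n + m) → E} {w : Fin (n + m) → F} (h : ∀ i j, v i < v j → w i < w j) :
    exceedances k v ≤ exceedances k w := by
  refine Finset.card_le_card (Finset.monotone_filter_right _ fun i _ hi => hi.trans ?_)
  exact Finset.card_le_card (Finset.monotone_filter_right _ fun j _ hj => h _ _ hj)

lemma exceedances_le (k : ℕ) (v : Fin (n + m) → ℝ) : exceedances k v ≤ m :=
  (Finset.card_le_univ _).trans_eq (Fintype.card_fin m)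

lemma exceedances_eq_zero {k : ℕ} (hk : n < k) (v : Fin (n + m) → ℝ) : exceedances k v = 0 := by
  rw [exceedances, Finset.card_eq_zero, Finset.filter_eq_empty_iff]
  intro i _ h
  have : calBelow v (v (Fin.natAdd n i)) ≤ n :=
    (Finset.card_le_univ _).trans_eq (Fintype.card_fin n)
  omega

/-- The calibration indices. -/
def calIdx (n m : ℕ) : Finset (Fin (n + m)) := Finset.univ.map (Fin.castAddEmb m)

/-- The test indices. -/
def testIdx (n m : ℕ) : Finset (Fin (n + m)) := Finset.univ.map (Fin.natAddEmb n)

/-- The `M` smallest values of `Fin N`. -/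
def bottom (N M : ℕ) : Finset (Fin N) := Finset.univ.filter fun i => i.val < M

lemma card_calIdx : (calIdx n m).card = n := by simp [calIdx]

lemma card_testIdx : (testIdx n m).card = m := by simp [testIdx]

lemma card_bottom {N M : ℕ} (h : M ≤ N) : (bottom N M).card = M := by
  rw [bottom, Fin.card_filter_val_lt, min_eq_right h]

lemma hits_calIdx (B : Finset (Fin (n + m))) (π : Equiv.Perm (Fin (n + m))) :
    hits (calIdx n m) B π = (Finset.univ.filter fun j : Fin n => π (Fin.castAdd m j) ∈ B).card := by
  rw [hits, calIdx, Finset.filter_map, Finset.card_map]; rfl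

lemma hits_testIdx (B : Finset (Fin (n + m))) (π : Equiv.Perm (Fin (n + m))) :
    hits (testIdx n m) B π = (Finset.univ.filter fun j : Fin m => π (Fin.natAdd n j) ∈ B).card := by
  rw [hits, testIdx, Finset.filter_map, Finset.card_map]; rfl

lemma hits_add_hits_compl {ι : Type*} [Fintype ι] [DecidableEq ι] (A B : Finset ι)
    (π : Equiv.Perm ι) : hits A B π + hits A Bᶜ π = A.card := by
  simp only [hits, Finset.mem_compl]
  exact Finset.card_filter_add_card_filter_not _

lemma hits_calIdx_add_hits_testIdx (B : Finset (Fin (n + m))) (π : Equiv.Perm (Fin (n + m))) :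
    hits (calIdx n m) B π + hits (testIdx n m) B π = B.card := by
  rw [hits_calIdx, hits_testIdx, Finset.card_filter, Finset.card_filter]
  rw [← Fin.sum_univ_add (fun i => if π i ∈ B then 1 else 0),
    Equiv.sum_comp π (fun i => if i ∈ B then 1 else 0)]
  simp

/-- With fewer than `k` calibration items in the bottom block, no exceeding test item could be in
it, so the block would hold at most `m - t` test items and be smaller than `m + k - t`. The second
bound follows by counting. -/
lemma hits_of_le_exceedances {k t : ℕ} (hk : k ≤ n) (ht : t ≤ m) (π : Equiv.Perm (Fin (n + m)))
    (h : t ≤ exceedances k π) :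
    k ≤ hits (calIdx n m) (bottom (n + m) (m + k - t)) π ∧
      t ≤ hits (testIdx n m) (bottom (n + m) (m + k - t))ᶜ π := by
  set B := bottom (n + m) (m + k - t) with hB
  have hBc : B.card = m + k - t := card_bottom (by omega)
  have e1 := hits_calIdx_add_hits_testIdx B π
  have e2 := hits_add_hits_compl (calIdx n m) B π
  have e3 := hits_add_hits_compl (testIdx n m) B π
  rw [card_calIdx] at e2
  rw [card_testIdx] at e3
  suffices hk' : k ≤ hits (calIdx n m) B π from ⟨hk', by omega⟩
  by_contra! hlt
  have : t ≤ hits (testIdx n m) Bᶜ π := by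
    refine h.trans ?_
    rw [hits_testIdx]
    refine Finset.card_le_card (Finset.monotone_filter_right _ fun i _ hi => ?_)
    by_contra hmem
    rw [Finset.mem_compl, not_not] at hmem
    refine absurd (hi.trans ?_) (not_le.mpr hlt)
    rw [hits_calIdx]
    refine Finset.card_le_card (Finset.monotone_filter_right _ fun j _ hj => ?_)
    simp only [hB, bottom, Finset.mem_filter, Finset.mem_univ, true_and] at hmem ⊢
    exact lt_trans (Fin.lt_def.mp hj) hmem
  omega

lemma card_perm_le_exceedances {k t : ℕ} (hn : 0 < n) (hm : 0 < m) (hk : k ≤ n) (ht : t ≤ m)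
    (hΔ : 0 ≤ (t : ℝ) / m - 1 + k / n) (v : Fin (n + m) → ℝ) :
    ((Finset.univ.filter fun σ : Equiv.Perm (Fin (n + m)) =>
        t ≤ exceedances k (fun i => v (σ i))).card : ℝ)
      ≤ (n + m).factorial * Real.exp (-(tau n m * ((t : ℝ) / m - 1 + k / n) ^ 2)) := by
  have : Nonempty (Fin (n + m)) := ⟨⟨0, by omega⟩⟩
  have hn' : (0 : ℝ) < n := by exact_mod_cast hn
  have hm' : (0 : ℝ) < m := by exact_mod_cast hm
  set Δ := (t : ℝ) / m - 1 + k / n with hΔdef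
  set B := bottom (n + m) (m + k - t) with hB
  have hBc : B.card = m + k - t := card_bottom (by omega)
  have hBc' : (B.card : ℝ) = m + k - t := by
    rw [hBc, Nat.cast_sub (by omega)]; push_cast; ring
  have hBcc : (Bᶜ.card : ℝ) = n - k + t := by
    rw [Finset.card_compl, Nat.cast_sub (Finset.card_le_univ _), hBc', Fintype.card_fin]
    push_cast; ring
  -- Replaces `v` by ranks with ties broken; strict inequalities survive, so exceedances can only
  -- increase.
  set π₀ : Equiv.Perm (Fin (n + m)) := (Tuple.sort v)⁻¹ with hπ₀
  have hsort : ∀ i j, v i < v j → π₀ i < π₀ j := by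
    intro i j hij
    by_contra! hle
    have := Tuple.monotone_sort v hle
    rw [Function.comp_apply, Function.comp_apply, hπ₀] at this
    simp only [Equiv.Perm.inv_def, Equiv.apply_symm_apply] at this
    exact absurd hij (not_lt.mpr this)
  have hhits : ∀ σ : Equiv.Perm (Fin (n + m)), t ≤ exceedances k (fun i => v (σ i)) →
      k ≤ hits (calIdx n m) B (π₀ * σ) ∧ t ≤ hits (testIdx n m) Bᶜ (π₀ * σ) := fun σ h =>
    hits_of_le_exceedances hk ht _ (h.trans
      (exceedances_le_of_lt_imp_lt k fun i j hij => hsort _ _ hij))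
  have hcard : ∀ Q : Equiv.Perm (Fin (n + m)) → Prop, ∀ [DecidablePred Q],
      (∀ σ, t ≤ exceedances k (fun i => v (σ i)) → Q (π₀ * σ)) →
      ((Finset.univ.filter fun σ : Equiv.Perm (Fin (n + m)) =>
        t ≤ exceedances k (fun i => v (σ i))).card : ℝ) ≤ (Finset.univ.filter Q).card := by
    intro Q _ hQ
    exact_mod_cast Finset.card_le_card_of_injOn (fun σ => π₀ * σ)
      (fun σ hσ => by simpa using hQ σ (by simpa using hσ)) (mul_right_injective π₀).injOn
  have hτ : 0 ≤ tau n m := by unfold tau; positivity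
  -- Both counts deviate from their means by `τ Δ`. Hoeffding on the smaller group gives `2 (τ Δ)² /
  -- min n m ≥ τ Δ²`, since `min n m ≤ 2 τ`.
  rcases le_total n m with hle | hle
  · have hle' : (n : ℝ) ≤ m := by exact_mod_cast hle
    refine (hcard (fun π => k ≤ hits (calIdx n m) B π) fun σ h => (hhits σ h).1).trans ?_
    have hdev : (k : ℝ) - n * ((m + k - t) / (n + m)) = tau n m * Δ := by
      rw [tau, hΔdef]; field_simp; ring
    have h := card_perm_le_hits_le (calIdx n m) B (by rwa [card_calIdx]) k (by
      rw [card_calIdx, hBc', Fintype.card_fin, Nat.cast_add]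
      linarith [mul_nonneg hτ hΔ])
    rw [card_calIdx, hBc', Fintype.card_fin, Nat.cast_add, hdev] at h
    refine h.trans ?_
    gcongr
    rw [le_div_iff₀ hn']
    have : (n : ℝ) ≤ 2 * tau n m := by
      rw [tau, ← mul_div_assoc, le_div_iff₀ (by positivity)]; nlinarith
    nlinarith [mul_nonneg hτ (sq_nonneg Δ)]
  · have hle' : (m : ℝ) ≤ n := by exact_mod_cast hle
    refine (hcard (fun π => t ≤ hits (testIdx n m) Bᶜ π) fun σ h => (hhits σ h).2).trans ?_
    have hdev : (t : ℝ) - m * ((n - k + t) / (n + m)) = tau n m * Δ := by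
      rw [tau, hΔdef]; field_simp; ring
    have h := card_perm_le_hits_le (testIdx n m) Bᶜ (by rwa [card_testIdx]) t (by
      rw [card_testIdx, hBcc, Fintype.card_fin, Nat.cast_add]
      linarith [mul_nonneg hτ hΔ])
    rw [card_testIdx, hBcc, Fintype.card_fin, Nat.cast_add, hdev] at h
    refine h.trans ?_
    gcongr
    rw [le_div_iff₀ hm']
    have : (m : ℝ) ≤ 2 * tau n m := by
      rw [tau, ← mul_div_assoc, le_div_iff₀ (by positivity)]; nlinarith
    nlinarith [mul_nonneg hτ (sq_nonneg Δ)]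

end Exceedances

/-! ### Consequences of exchangeability. -/

section Exchangeable

variable {Ω : Type*} [MeasurableSpace Ω] {P : Measure Ω}

lemma IsExchangeable.measureReal_perm {E : Type*} [MeasurableSpace E] {N : ℕ} {Z : Fin N → Ω → E}
    (h : IsExchangeable P Z) (σ : Equiv.Perm (Fin N)) {B : Set (Fin N → E)}
    (hB : MeasurableSet B) :
    P.real {ω | (fun i => Z (σ i) ω) ∈ B} = P.real {ω | (fun i => Z i ω) ∈ B} :=
  congrArg ENNReal.toReal ((h σ).measure_mem_eq hB)

open Classical in
lemma IsExchangeable.measureReal_le [IsProbabilityMeasure P] {E : Type*} [MeasurableSpace E] {N : ℕ} {Z : Fin N → Ω → E}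
    (h : IsExchangeable P Z) (hZ : ∀ i, Measurable (Z i)) {B : Set (Fin N → E)}
    (hB : MeasurableSet B) {c : ℝ}
    (hc : ∀ z : Fin N → E, ((Finset.univ.filter fun σ : Equiv.Perm (Fin N) =>
      (fun i => z (σ i)) ∈ B).card : ℝ) ≤ N.factorial * c) :
    P.real {ω | (fun i => Z i ω) ∈ B} ≤ c := by
  have hmeas : ∀ σ : Equiv.Perm (Fin N), MeasurableSet {ω | (fun i => Z (σ i) ω) ∈ B} :=
    fun σ => (measurable_pi_lambda _ fun i => hZ (σ i)) hB
  have hint : ∀ σ : Equiv.Perm (Fin N),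
      Integrable ({ω | (fun i => Z (σ i) ω) ∈ B}.indicator (1 : Ω → ℝ)) P :=
    fun σ => (integrable_const (1 : ℝ)).indicator (hmeas σ)
  have hsum : (N.factorial : ℝ) * P.real {ω | (fun i => Z i ω) ∈ B} ≤ N.factorial * c := by
    calc (N.factorial : ℝ) * P.real {ω | (fun i => Z i ω) ∈ B}
        = ∑ σ : Equiv.Perm (Fin N), P.real {ω | (fun i => Z (σ i) ω) ∈ B} := by
          simp_rw [h.measureReal_perm _ hB]
          rw [Finset.sum_const, Finset.card_univ, Fintype.card_perm, Fintype.card_fin,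
            nsmul_eq_mul]
      _ = ∫ ω, ∑ σ : Equiv.Perm (Fin N),
            {ω | (fun i => Z (σ i) ω) ∈ B}.indicator (1 : Ω → ℝ) ω ∂P := by
          rw [integral_finsetSum _ fun σ _ => hint σ]
          exact Finset.sum_congr rfl fun σ _ => (integral_indicator_one (hmeas σ)).symm
      _ ≤ ∫ _, (N.factorial : ℝ) * c ∂P := by
          refine integral_mono (integrable_finsetSum _ fun σ _ => hint σ) (integrable_const _)
            fun ω => ?_
          refine le_trans (le_of_eq ?_) (hc fun i => Z i ω)
          rw [Finset.card_filter]; push_cast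
          exact Finset.sum_congr rfl fun σ _ => by simp [Set.indicator_apply]
      _ = _ := by simp
  exact le_of_mul_le_mul_left hsum (by exact_mod_cast N.factorial_pos)

/-- If some index has at least `k` values below it, take one of least value: by minimality,
everything below it is counted. Ties are harmless. -/
lemma card_le_card_filter_lt {ι : Type*} [DecidableEq ι] (J : Finset ι) (v : ι → ℝ) {k : ℕ}
    (hk : k ≤ J.card) :
    k ≤ (J.filter fun l => (J.filter fun j => v j < v l).card < k).card := by
  by_cases hall : ∀ l ∈ J, (J.filter fun j => v j < v l).card < k
  · rwa [Finset.filter_true_of_mem hall]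
  push Not at hall
  obtain ⟨l₀, hl₀⟩ := hall
  obtain ⟨l, hl, hmin⟩ := Finset.exists_min_image
    (J.filter fun l => k ≤ (J.filter fun j => v j < v l).card) v
    ⟨l₀, Finset.mem_filter.mpr hl₀⟩
  refine (Finset.mem_filter.mp hl).2.trans (Finset.card_le_card fun j hj => ?_)
  obtain ⟨hjJ, hlt⟩ := Finset.mem_filter.mp hj
  refine Finset.mem_filter.mpr ⟨hjJ, ?_⟩
  by_contra! hge
  exact absurd (hmin j (Finset.mem_filter.mpr ⟨hjJ, hge⟩)) (not_le.mpr hlt)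

lemma measurable_calBelow {n m : ℕ} (i : Fin (n + m)) :
    Measurable fun v : Fin (n + m) → ℝ => calBelow v (v i) := by
  simp only [calBelow, Finset.card_filter]
  exact Finset.measurable_sum _ fun j _ => Measurable.ite
    (measurableSet_lt (measurable_pi_apply _) (measurable_pi_apply _))
    measurable_const measurable_const

lemma measurable_exceedances {n m : ℕ} (k : ℕ) :
    Measurable fun v : Fin (n + m) → ℝ => exceedances k v := by
  simp only [exceedances, Finset.card_filter]
  exact Finset.measurable_sum _ fun i _ => Measurable.ite
    (measurableSet_le measurable_const (measurable_calBelow _))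
    measurable_const measurable_const

/-- Among exchangeable variables, a test one exceeds fewer than `k` calibration ones with
probability at least `k / (n + 1)`. -/
lemma IsExchangeable.le_measureReal_calBelow_lt [IsProbabilityMeasure P] {n m : ℕ} {V : Fin (n + m) → Ω → ℝ}
    (h : IsExchangeable P V) (hV : ∀ i, Measurable (V i)) {k : ℕ} (hk : k ≤ n + 1) (i : Fin m) :
    (k : ℝ) / (n + 1) ≤
      P.real {ω | calBelow (fun j => V j ω) (V (Fin.natAdd n i) ω) < k} := by
  set i₀ := Fin.natAdd n i with hi₀
  have hi₀mem : i₀ ∉ calIdx n m := by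
    simp only [calIdx, Finset.mem_map, Finset.mem_univ, true_and, not_exists, hi₀]
    intro j hj
    have := congrArg Fin.val hj
    simp at this
    omega
  set J := insert i₀ (calIdx n m) with hJ
  have hJc : J.card = n + 1 := by rw [hJ, Finset.card_insert_of_notMem hi₀mem, card_calIdx]
  let A : Fin (n + m) → Set (Fin (n + m) → ℝ) := fun l =>
    {v | (J.filter fun j => v j < v l).card < k}
  have hA : ∀ l, MeasurableSet (A l) := by
    intro l
    refine measurableSet_lt ?_ measurable_const
    simp only [Finset.card_filter]
    exact Finset.measurable_sum _ fun j _ => Measurable.ite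
      (measurableSet_lt (measurable_pi_apply _) (measurable_pi_apply _))
      measurable_const measurable_const
  have hA₀ : {ω | (fun j => V j ω) ∈ A i₀} =
      {ω | calBelow (fun j => V j ω) (V i₀ ω) < k} := by
    ext ω
    -- `i₀` is not strictly below itself, so including it in `J` leaves the count unchanged.
    simp only [A, Set.mem_ofPred_eq, calBelow, hJ, Finset.filter_insert, lt_irrefl, if_false, calIdx,
      Finset.filter_map, Finset.card_map]
    rfl
  have heq : ∀ l ∈ J, P.real {ω | (fun j => V j ω) ∈ A l} =
      P.real {ω | (fun j => V j ω) ∈ A i₀} := by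
    intro l hl
    rw [← h.measureReal_perm (Equiv.swap i₀ l) (hA i₀)]
    congr 1
    ext ω
    simp only [A, Set.mem_ofPred_eq, Equiv.swap_apply_left]
    have hbij : (J.filter fun j => V j ω < V l ω).card =
        (J.filter fun j => V (Equiv.swap i₀ l j) ω < V l ω).card := by
      have hswap : ∀ j ∈ J, Equiv.swap i₀ l j ∈ J := by
        intro j hj
        rw [Equiv.swap_apply_def]
        split_ifs
        · exact hl
        · exact Finset.mem_insert_self _ _
        · exact hj
      refine Finset.card_bij' (fun j _ => Equiv.swap i₀ l j) (fun j _ => Equiv.swap i₀ l j)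
        ?_ ?_ (fun j _ => Equiv.swap_apply_self _ _ _) (fun j _ => Equiv.swap_apply_self _ _ _)
      · intro j hj
        rw [Finset.mem_filter] at hj ⊢
        exact ⟨hswap j hj.1, by simpa using hj.2⟩
      · intro j hj
        rw [Finset.mem_filter] at hj ⊢
        exact ⟨hswap j hj.1, hj.2⟩
    rw [hbij]
  have hmeas : ∀ l, MeasurableSet {ω | (fun j => V j ω) ∈ A l} :=
    fun l => (measurable_pi_lambda _ hV) (hA l)
  have hint : ∀ l, Integrable ({ω | (fun j => V j ω) ∈ A l}.indicator (1 : Ω → ℝ)) P :=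
    fun l => (integrable_const (1 : ℝ)).indicator (hmeas l)
  rw [← hA₀, div_le_iff₀ (by positivity)]
  calc (k : ℝ) = ∫ _, (k : ℝ) ∂P := by simp
    _ ≤ ∫ ω, ∑ l ∈ J, {ω | (fun j => V j ω) ∈ A l}.indicator (1 : Ω → ℝ) ω ∂P := by
        refine integral_mono (integrable_const _) (integrable_finsetSum _ fun l _ => hint l)
          fun ω => ?_
        have := card_le_card_filter_lt J (fun j => V j ω) (k := k) (by rwa [hJc])
        rw [Finset.card_filter] at this
        refine (Nat.cast_le (α := ℝ).mpr this).trans (le_of_eq ?_)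
        push_cast
        exact Finset.sum_congr rfl fun l _ => by simp [Set.indicator_apply, A]
    _ = ∑ l ∈ J, P.real {ω | (fun j => V j ω) ∈ A l} := by
        rw [integral_finsetSum _ fun l _ => hint l]
        exact Finset.sum_congr rfl fun l _ => integral_indicator_one (hmeas l)
    _ = _ := by
        rw [Finset.sum_congr rfl heq, Finset.sum_const, hJc, nsmul_eq_mul]; push_cast; ring

end Exchangeable

end RankConformal

namespace RankConformal

/-! ### Coverage on the envelope event, pointwise. -/

section Deterministic

lemma rank_bag {ι : Type*} [Fintype ι] (c : ℝ) (f : ι → ℝ) :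
    rank c (bag f) = (Finset.univ.filter fun j => f j ≤ c).card := by
  rw [rank, bag, Multiset.map_map, Finset.card_filter]; rfl

lemma bag_comp_perm {ι E : Type*} [Fintype ι] (f : ι → E) (σ : Equiv.Perm ι) :
    bag (fun i => f (σ i)) = bag f := by
  have := congrArg (Multiset.map f) (Multiset.map_univ_val_equiv σ)
  rwa [Multiset.map_map] at this

variable {n m : ℕ} {𝒳 : Type*}

lemma fullRank_eq_card (y : Fin (n + m) → ℝ) (i : Fin (n + m)) :
    fullRank y i = (Finset.univ.filter fun j => y j ≤ y i).card := rank_bag _ _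

lemma fullRank_eq_add_testRank (y : Fin (n + m) → ℝ) (i : Fin (n + m)) :
    fullRank y i
      = (Finset.univ.filter fun j : Fin n => y (Fin.castAdd m j) ≤ y i).card + testRank y i := by
  rw [fullRank_eq_card, testRank, rank_bag, Finset.card_filter, Finset.card_filter,
    Finset.card_filter, Fin.sum_univ_add]

lemma fullRank_le_fullRank_iff (y : Fin (n + m) → ℝ) (i j : Fin (n + m)) :
    fullRank y j ≤ fullRank y i ↔ y j ≤ y i := by
  rw [fullRank_eq_card, fullRank_eq_card]
  refine ⟨fun h => ?_, fun h => Finset.card_le_card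
    (Finset.monotone_filter_right _ fun l _ hl => hl.trans h)⟩
  by_contra! hlt
  refine absurd h (not_le.mpr (Finset.card_lt_card ?_))
  refine Finset.ssubset_iff_subset_ne.mpr
    ⟨Finset.monotone_filter_right _ fun l _ hl => hl.trans hlt.le, fun heq => ?_⟩
  have : j ∈ Finset.univ.filter fun l => y l ≤ y i := by rw [heq]; simp
  exact absurd (Finset.mem_filter.mp this).2 (not_le.mpr hlt)

lemma fullRank_mem_Icc (y : Fin (n + m) → ℝ) (i : Fin (n + m)) :
    fullRank y i ∈ Finset.Icc 1 (n + m) := by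
  rw [fullRank_eq_card, Finset.mem_Icc]
  exact ⟨Finset.card_pos.mpr ⟨i, by simp⟩,
    (Finset.card_le_univ _).trans_eq (Fintype.card_fin _)⟩

/-- The score of each item at its true rank. -/
def trueScore (s : 𝒳 → ℕ → Multiset 𝒳 → ℝ) (x : Fin (n + m) → 𝒳) (r : Fin (n + m) → ℕ)
    (i : Fin (n + m)) : ℝ :=
  s (x i) (r i) (bag x)

lemma fullRank_mem_confSet (s : 𝒳 → ℕ → Multiset 𝒳 → ℝ) (x : Fin (n + m) → 𝒳)
    (y : Fin (n + m) → ℝ) (lo hi : Fin n → ℝ) (k : ℕ)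
    (henv : ∀ j : Fin n, (fullRank y (Fin.castAdd m j) : ℝ) ∈ Set.Icc (lo j) (hi j))
    (i : Fin (n + m))
    (hlt : calBelow (trueScore s x (fullRank y)) (trueScore s x (fullRank y) i) < k) :
    fullRank y i ∈ confSet s x lo hi k (x i) := by
  -- A threshold `t` below the score of `i` would put `k` proxy scores, hence `k` true calibration
  -- scores, strictly below it.
  refine ⟨fullRank_mem_Icc y i, le_sInf fun t ht => ?_⟩
  by_contra! hsup
  refine absurd hlt (not_lt.mpr (ht.trans (Finset.card_le_card
    (Finset.monotone_filter_right _ fun j _ hj => ?_))))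
  have hle : ((trueScore s x (fullRank y) (Fin.castAdd m j) : ℝ) : EReal)
      ≤ proxyScore s x lo hi j :=
    Finset.le_sup (f := fun r => ((s (x (Fin.castAdd m j)) r (bag x) : ℝ) : EReal))
      (Finset.mem_filter.mpr ⟨fullRank_mem_Icc y _, henv j⟩)
  exact EReal.coe_lt_coe_iff.mp ((hle.trans hj).trans_lt hsup)

lemma testRank_mem_testConfSet (s : 𝒳 → ℕ → Multiset 𝒳 → ℝ) (x : Fin (n + m) → 𝒳)
    (y : Fin (n + m) → ℝ) (lo hi : Fin n → ℝ) (k : ℕ)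
    (henv : ∀ j : Fin n, (fullRank y (Fin.castAdd m j) : ℝ) ∈ Set.Icc (lo j) (hi j))
    (i : Fin (n + m))
    (hlt : calBelow (trueScore s x (fullRank y)) (trueScore s x (fullRank y) i) < k) :
    (testRank y i : ℝ) ∈ testConfSet s x lo hi k (x i) := by
  have hmem := fullRank_mem_confSet s x y lo hi k henv i hlt
  have hbdd : BddAbove (confSet s x lo hi k (x i)) :=
    ⟨n + m, fun r hr => (Finset.mem_Icc.mp hr.1).2⟩
  refine ⟨sInf (confSet s x lo hi k (x i)), sSup (confSet s x lo hi k (x i)),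
    ⟨Nat.sInf_mem ⟨_, hmem⟩, fun r hr => Nat.sInf_le hr⟩,
    ⟨Nat.sSup_mem ⟨_, hmem⟩ hbdd, fun r hr => le_csSup hbdd hr⟩, ?_⟩
  have ha := Nat.sInf_le hmem
  have hb := le_csSup hbdd hmem
  generalize sInf (confSet s x lo hi k (x i)) = a at ha ⊢
  generalize sSup (confSet s x lo hi k (x i)) = b at hb ⊢
  have hadd := fullRank_eq_add_testRank y i
  have hcal : ∀ j : Fin n, y (Fin.castAdd m j) ≤ y i ↔
      fullRank y (Fin.castAdd m j) ≤ fullRank y i := fun j => (fullRank_le_fullRank_iff y i _).symm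
  simp only [hcal] at hadd
  set c := (Finset.univ.filter fun j : Fin n =>
    fullRank y (Fin.castAdd m j) ≤ fullRank y i).card
  have hlo : c ≤ boundCount lo b := Finset.card_le_card
    (Finset.monotone_filter_right _ fun j _ hj =>
      (henv j).1.trans (Nat.cast_le.mpr (hj.trans hb)))
  have hhi : boundCount hi a ≤ c := Finset.card_le_card
    (Finset.monotone_filter_right _ fun j _ hj =>
      Nat.cast_le.mp (((henv j).2.trans hj).trans (Nat.cast_le.mpr ha)))
  have hadd' : (fullRank y i : ℝ) = c + testRank y i := by exact_mod_cast hadd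
  have h1 : (a : ℝ) ≤ fullRank y i := by exact_mod_cast ha
  have h2 : (fullRank y i : ℝ) ≤ b := by exact_mod_cast hb
  have h3 : (c : ℝ) ≤ boundCount lo b := by exact_mod_cast hlo
  have h4 : (boundCount hi a : ℝ) ≤ c := by exact_mod_cast hhi
  constructor <;> linarith

lemma testFCP_le (s : 𝒳 → ℕ → Multiset 𝒳 → ℝ) (x : Fin (n + m) → 𝒳)
    (y : Fin (n + m) → ℝ) (lo hi : Fin n → ℝ) (k : ℕ)
    (henv : ∀ j : Fin n, (fullRank y (Fin.castAdd m j) : ℝ) ∈ Set.Icc (lo j) (hi j)) :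
    testFCP s x y lo hi k ≤ 1 / (m : ℝ) * exceedances k (trueScore s x (fullRank y)) := by
  refine mul_le_mul_of_nonneg_left ?_ (by positivity)
  rw [exceedances, Finset.card_filter]
  push_cast
  refine Finset.sum_le_sum fun i _ => ?_
  split_ifs with h
  · exact Set.indicator_le_self' (fun _ _ => zero_le_one) _
  · rw [Set.indicator_of_notMem]
    exact fun hc => hc (testRank_mem_testConfSet s x y lo hi k henv _ (not_le.mp h))

end Deterministic

/-! ### Exchangeability of the true scores and the deviation `λ`. -/

section Scores

variable {Ω 𝒳 : Type*} [MeasurableSpace Ω] [MeasurableSpace 𝒳] {P : Measure Ω} {n m : ℕ}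
  {s : 𝒳 → ℕ → Multiset 𝒳 → ℝ}

lemma measurable_fullRank {Y : Fin (n + m) → Ω → ℝ} (hY : ∀ i, Measurable (Y i))
    (i : Fin (n + m)) : Measurable fun ω => fullRank (fun j => Y j ω) i := by
  simp only [fullRank_eq_card, Finset.card_filter]
  exact Finset.measurable_sum _ fun j _ => Measurable.ite
    (measurableSet_le (hY j) (hY i)) measurable_const measurable_const

lemma measurable_trueScore
    (hs : ∀ r, Measurable fun p : 𝒳 × (Fin (n + m) → 𝒳) => s p.1 r (bag p.2)) :
    Measurable fun z : Fin (n + m) → 𝒳 × ℕ =>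
      trueScore s (fun i => (z i).1) (fun i => (z i).2) := by
  refine measurable_pi_lambda _ fun i => ?_
  have h : Measurable fun q : (𝒳 × (Fin (n + m) → 𝒳)) × ℕ => s q.1.1 q.2 (bag q.1.2) :=
    measurable_from_prod_countable_left hs
  have hz : ∀ j, Measurable fun z : Fin (n + m) → 𝒳 × ℕ => (z j).1 :=
    fun j => (measurable_pi_apply j).fst
  exact h.comp (((hz i).prodMk (measurable_pi_lambda _ hz)).prodMk (measurable_pi_apply i).snd)

lemma IsExchangeable.trueScore {X : Fin (n + m) → Ω → 𝒳} {R : Fin (n + m) → Ω → ℕ}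
    (h : IsExchangeable P fun i ω => (X i ω, R i ω))
    (hs : ∀ r, Measurable fun p : 𝒳 × (Fin (n + m) → 𝒳) => s p.1 r (bag p.2)) :
    IsExchangeable P fun i ω => trueScore s (fun j => X j ω) (fun j => R j ω) i := by
  intro σ
  have := (h σ).comp (measurable_trueScore hs)
  convert this using 1
  · funext ω i
    exact congrArg (s (X (σ i) ω) (R (σ i) ω)) (bag_comp_perm (fun j => X j ω) σ).symm
  · rfl

lemma measureReal_add_sub_one_le_inter [IsProbabilityMeasure P] {A E : Set Ω}
    (hA : MeasurableSet A) : P.real A + P.real E - 1 ≤ P.real (E ∩ A) := by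
  have h := measureReal_union_add_inter (μ := P) (s := E) hA
  have h1 : P.real (E ∪ A) ≤ 1 := measureReal_le_one
  linarith

lemma half_le_tau (hn : 0 < n) (hm : 0 < m) : 1 / 2 ≤ tau n m := by
  have hn' : (1 : ℝ) ≤ n := by exact_mod_cast hn
  have hm' : (1 : ℝ) ≤ m := by exact_mod_cast hm
  rw [tau, div_le_div_iff₀ (by norm_num) (by linarith)]
  nlinarith

/-- The exponential equals `β / (C √τ)`, and `τ ≥ 1/2` makes `C √τ ≥ 1`; this also keeps the
logarithm nonnegative, so the square root is not truncated. -/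
lemma exp_neg_tau_mul_lam_sq_le (hn : 0 < n) (hm : 0 < m) {β : ℝ} (hβ : 0 < β) (hβ1 : β ≤ 1) :
    Real.exp (-(tau n m * lam n m β ^ 2)) ≤ β := by
  have hτ := half_le_tau hn hm
  have hτ0 : 0 < tau n m := by linarith
  have hC : 1 ≤ 4 * √(2 * Real.pi) * √(tau n m) := by
    rw [mul_assoc, ← Real.sqrt_mul (by positivity)]
    have : 1 ≤ √(2 * Real.pi * tau n m) := by
      rw [Real.one_le_sqrt]
      nlinarith [Real.pi_gt_three]
    linarith
  have hlog : -Real.log β ≤ Real.log (4 * √(2 * Real.pi) * √(tau n m) / β) := by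
    rw [Real.log_div (by linarith) hβ.ne']
    linarith [Real.log_nonneg hC]
  have hlogβ := Real.log_nonpos hβ.le hβ1
  rw [lam, Real.sq_sqrt (div_nonneg (by linarith) hτ0.le), mul_div_cancel₀ _ hτ0.ne',
    ← Real.le_log_iff_exp_le hβ]
  linarith

lemma IsExchangeable.measureReal_le_exceedances [IsProbabilityMeasure P]
    {V : Fin (n + m) → Ω → ℝ} (h : IsExchangeable P V) (hV : ∀ i, Measurable (V i))
    (hn : 0 < n) (hm : 0 < m) {α β : ℝ} (hα1 : α < 1) (hβ : 0 < β) (hβ1 : β ≤ 1) :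
    P.real {ω | ⌊m * (α + lam n m β)⌋₊ + 1 ≤
      exceedances ⌈(1 - α) * ((n : ℝ) + 1)⌉₊ fun j => V j ω} ≤ β := by
  set k := ⌈(1 - α) * ((n : ℝ) + 1)⌉₊ with hk
  set t := ⌊m * (α + lam n m β)⌋₊ + 1 with ht
  have hn' : (0 : ℝ) < n := by exact_mod_cast hn
  have hm' : (0 : ℝ) < m := by exact_mod_cast hm
  have hlam : 0 ≤ lam n m β := Real.sqrt_nonneg _
  refine le_trans ?_ (exp_neg_tau_mul_lam_sq_le hn hm hβ hβ1)
  by_cases hc : k ≤ n ∧ t ≤ m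
  · have hΔ : lam n m β ≤ (t : ℝ) / m - 1 + k / n := by
      have h1 : α + lam n m β ≤ t / m := by
        rw [le_div_iff₀ hm', ht, mul_comm]
        exact_mod_cast (Nat.lt_floor_add_one _).le
      have h2 : 1 - α ≤ k / n := by
        rw [le_div_iff₀ hn']
        have := Nat.le_ceil ((1 - α) * ((n : ℝ) + 1))
        linarith
      linarith
    have hB : MeasurableSet {v : Fin (n + m) → ℝ | t ≤ exceedances k v} :=
      measurableSet_le measurable_const (measurable_exceedances k)
    refine (h.measureReal_le hV hB
      (c := Real.exp (-(tau n m * ((t : ℝ) / m - 1 + k / n) ^ 2))) fun v => ?_).trans ?_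
    · convert card_perm_le_exceedances hn hm hc.1 hc.2 (hlam.trans hΔ) v
      rfl
    · have := half_le_tau hn hm
      gcongr
  -- If `k > n` nothing exceeds, and if `t > m` there are too few test items; `t ≥ 1` excludes the
  -- trivial event.
  · have : {ω | t ≤ exceedances k fun j => V j ω} = ∅ := by
      refine Set.eq_empty_of_forall_notMem fun ω hω => hc ?_
      have hω : t ≤ exceedances k fun j => V j ω := hω
      have hle := exceedances_le k fun j => V j ω
      refine ⟨?_, by omega⟩
      by_contra! hkn
      rw [exceedances_eq_zero hkn] at hω
      omega
    rw [this, measureReal_empty]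
    positivity

end Scores

end RankConformal

theorem corollary1 {Ω 𝒳 : Type*} [MeasurableSpace Ω] [MeasurableSpace 𝒳]
    (P : Measure Ω) [IsProbabilityMeasure P]
    (n m : ℕ) (hn : 0 < n) (hm : 0 < m)
    (X : Fin (n + m) → Ω → 𝒳) (Y : Fin (n + m) → Ω → ℝ)
    (hX : ∀ i, Measurable (X i)) (hY : ∀ i, Measurable (Y i))
    -- the values are exchangeable and have no ties
    (hYexch : RankConformal.IsExchangeable P Y)
    (hYties : ∀ᵐ ω ∂P, Function.Injective fun i => Y i ω)
    -- the pairs (feature, rank among all the items) are exchangeable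
    (hXRexch : RankConformal.IsExchangeable P
      fun i ω => (X i ω, RankConformal.fullRank (fun j => Y j ω) i))
    -- an arbitrary (measurable) score function
    (s : 𝒳 → ℕ → Multiset 𝒳 → ℝ)
    (hs : ∀ r, Measurable fun p : 𝒳 × (Fin (n + m) → 𝒳) => s p.1 r (RankConformal.bag p.2))
    -- the envelope of the calibration ranks
    (Rminus Rplus : Fin n → Ω → ℝ)
    (hRminus : ∀ i, Measurable (Rminus i)) (hRplus : ∀ i, Measurable (Rplus i))
    (α δ : ℝ) (hα : α ∈ Set.Ioo (0 : ℝ) 1)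
    (henv : 1 - δ ≤ P.real {ω | ∀ i : Fin n,
      (RankConformal.fullRank (fun j => Y j ω) (Fin.castAdd m i) : ℝ) ∈
        Set.Icc (Rminus i ω) (Rplus i ω)}) :
    -- marginal validity
    (δ < α → ∀ i : Fin m,
      1 - α ≤ P.real {ω |
        (RankConformal.testRank (fun j => Y j ω) (Fin.natAdd n i) : ℝ) ∈
          RankConformal.testConfSet s (fun j => X j ω) (fun j => Rminus j ω)
            (fun j => Rplus j ω) ⌈(1 - α + δ) * ((n : ℝ) + 1)⌉₊ (X (Fin.natAdd n i) ω)}) ∧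
    -- control of the false coverage proportion
    (∀ β : ℝ, 0 < β →
      1 - β - δ ≤ P.real {ω |
        RankConformal.testFCP s (fun j => X j ω) (fun j => Y j ω) (fun j => Rminus j ω)
            (fun j => Rplus j ω) ⌈(1 - α) * ((n : ℝ) + 1)⌉₊ ≤
          α + RankConformal.lam n m β}) := by

  set Z : Fin (n + m) → Ω → ℝ := fun i ω => RankConformal.trueScore s (fun j => X j ω)
    (RankConformal.fullRank fun j => Y j ω) i with hZ
  have hZexch : RankConformal.IsExchangeable P Z := hXRexch.trueScore hs
  have hZmeas : ∀ i, Measurable (Z i) := fun i =>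
    (measurable_pi_apply i).comp ((RankConformal.measurable_trueScore hs).comp
      (measurable_pi_lambda _ fun j =>
        (hX j).prodMk (RankConformal.measurable_fullRank hY j)))
  have hδ : 0 ≤ δ := by linarith [henv.trans measureReal_le_one]
  obtain ⟨hα0, hα1⟩ := hα
  set E := {ω | ∀ i : Fin n,
      (RankConformal.fullRank (fun j => Y j ω) (Fin.castAdd m i) : ℝ) ∈
        Set.Icc (Rminus i ω) (Rplus i ω)} with hE
  constructor
  · intro hδα i
    -- The extra `δ` in the level pays for intersecting with the envelope event.
    set k := ⌈(1 - α + δ) * ((n : ℝ) + 1)⌉₊ with hk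
    have hkn : k ≤ n + 1 := by
      rw [hk, Nat.ceil_le]
      push_cast
      nlinarith
    have hprob := hZexch.le_measureReal_calBelow_lt hZmeas hkn i
    have hk' : 1 - α + δ ≤ (k : ℝ) / (n + 1) := by
      rw [le_div_iff₀ (by positivity)]
      exact Nat.le_ceil _
    have hA : MeasurableSet {ω | RankConformal.calBelow (fun j => Z j ω)
        (Z (Fin.natAdd n i) ω) < k} :=
      measurableSet_lt ((RankConformal.measurable_calBelow (Fin.natAdd n i)).comp
        (measurable_pi_lambda _ hZmeas)) measurable_const
    have hinter := RankConformal.measureReal_add_sub_one_le_inter (P := P) (E := E) hA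
    refine le_trans (by linarith) (hinter.trans (measureReal_mono ?_))
    exact fun ω hω => RankConformal.testRank_mem_testConfSet s _ _ _ _ k hω.1 _ hω.2
  · intro β hβ
    rcases le_or_gt 1 β with hβ1 | hβ1
    · exact le_trans (by linarith) measureReal_nonneg
    set k := ⌈(1 - α) * ((n : ℝ) + 1)⌉₊ with hk
    have hprob := hZexch.measureReal_le_exceedances hZmeas hn hm hα1 hβ hβ1.le
    have hB : MeasurableSet {ω | ⌊m * (α + RankConformal.lam n m β)⌋₊ + 1 ≤
        RankConformal.exceedances k fun j => Z j ω} :=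
      measurableSet_le measurable_const ((RankConformal.measurable_exceedances k).comp
        (measurable_pi_lambda _ hZmeas))
    have hinter := RankConformal.measureReal_add_sub_one_le_inter (P := P) (E := E) hB.compl
    rw [probReal_compl_eq_one_sub hB] at hinter
    refine le_trans (by linarith) (hinter.trans (measureReal_mono ?_))
    intro ω hω
    have hm' : (0 : ℝ) < m := by exact_mod_cast hm
    have hlam : 0 ≤ RankConformal.lam n m β := Real.sqrt_nonneg _
    have hexc : RankConformal.exceedances k (fun j => Z j ω) ≤
        ⌊m * (α + RankConformal.lam n m β)⌋₊ := Nat.lt_succ_iff.mp (not_le.mp hω.2)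
    have hexc' := (Nat.le_floor_iff (by positivity)).mp hexc
    refine (RankConformal.testFCP_le s _ _ _ _ k hω.1).trans ?_
    rw [one_div_mul_eq_div, div_le_iff₀ hm', mul_comm _ (m : ℝ)]
    exact hexc'
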